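/- Conventions. All extriangulated categories $(\mathcal E,\mathbb E,\mathfrak s)$ (in the sense of Nakaoka and Palu) are assumed to satisfy condition (WIC): if $gf$ is a deflation then $g$ is a deflation, and if $gf$ is an inflation then $f$ is an inflation. A *subcategory* is full and closed under isomorphisms, direct sums and direct summands. A *cotorsion pair* in $\mathcal E$ is a pair $(\mathcal U,\mathcal V)$ of subcategories such that $\mathbb E(\mathcal U,\mathcal V)=0$ and every $B\in\mathcal E$ admits $\mathbb E$-triangles $V_B\to U_B\to B\dashrightarrow$ and $B\to V^B\to U^B\dashrightarrow$ with $U_B,U^B\in\mathcal U$ and $V_B,V^B\in\mathcal V$. For a class $\mathcal V$ of objects, ${}^{\perp_1}\mathcal V=\{X\mid \mathbb E(X,V)=0\text{ for all }V\in\mathcal V\}$, and $\mathsf{add}\,\mathcal V$ is the class of direct summands of finite direct sums of objects of $\mathcal V$. $\mathcal E$ has *enough projectives* if every object $X$ admits an $\mathbb E$-triangle $K\to P\to X\dashrightarrow$ with $P$ projective. A morphism is *compatible* if it is an isomorphism or is not both an inflation and a deflation. A sequence $X\xrightarrow{f}Y\xrightarrow{g}Z$ is *right exact* if $f=h_2h_1$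 for a compatible deflation $h_1:X\to K$ and an $\mathbb E$-triangle $K\xrightarrow{h_2}Y\xrightarrow{g}Z\dashrightarrow$. A four-term sequence $W\xrightarrow{f}X\xrightarrow{g}Y\xrightarrow{h}Z$ is *right exact* (resp. *left exact*) if there are $\mathbb E$-triangles $W\xrightarrow{f}X\xrightarrow{g_1}K\dashrightarrow$ and $K\xrightarrow{g_2}Y\xrightarrow{h}Z\dashrightarrow$ with $g=g_2g_1$ and $g_1$ (resp. $g_2$) compatible. An additive functor $F$ is *exact* if it preserves compatible morphisms and there is a natural transformation $\eta:\mathbb E(-,-)\to\mathbb E(F-,F-)$ such that $\mathfrak s(\delta)=[X\to Y\to Z]$ implies $\mathfrak s(\eta(\delta))=[FX\to FY\to FZ]$. It is *right exact* if it preserves compatible morphisms and right exact three-term sequences, and to each $\delta\in\mathbb E(Z,X)$ one can assign an object $A'_\delta$, a compatible deflation $q_\delta:FX\to A'_\delta$ and $\eta(\delta)\in\mathbb E(FZ,A'_\delta)$ such that: whenever $\mathfrak s(\delta)=[X\xrightarrow{x}Y\xrightarrow{y}Z]$, there is $x':A'_\delta\to FY$ with $x'q_\delta=F(x)$ and $\mathfrak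 s(\eta(\delta))=[A'_\delta\xrightarrow{x'}FY\xrightarrow{F(y)}FZ]$; and for every morphism of extensions $(a,c):\delta\to\delta'$ there is $a':A'_\delta\to A'_{\delta'}$ with $a'q_\delta=q_{\delta'}F(a)$ and $a'_*\eta(\delta)=F(c)^*\eta(\delta')$. *Left exact* sequences $X\to Y\to Z$ and functors are defined dually. A *recollement* $(\mathcal A,\mathcal B,\mathcal C)$ of extriangulated categories consists of exact functors $i_*:\mathcal A\to\mathcal B$, $j^*:\mathcal B\to\mathcal C$, right exact functors $i^*:\mathcal B\to\mathcal A$, $j_!:\mathcal C\to\mathcal B$ and left exact functors $i^!:\mathcal B\to\mathcal A$, $j_*:\mathcal C\to\mathcal B$ such that - (R1) $i^*\dashv i_*\dashv i^!$ and $j_!\dashv j^*\dashv j_*$; - (R2) an object of $\mathcal B$ is isomorphic to some $i_*A$ with $A\in\mathcal A$ if and only if $j^*$ sends it to $0$; - (R3) $i_*$, $j_!$, $j_*$ are fully faithful; - (R4) for each $X\in\mathcal B$ there is a left exact four-term sequence $i_*i^!X\to X\to j_*j^*X\to i_*A$ with $A\in\mathcal A$, whose first two morphisms are the adjunction morphisms;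 - (R5) for each $X\in\mathcal B$ there is a right exact four-term sequence $i_*A'\to j_!j^*X\to X\to i_*i^*X$ with $A'\in\mathcal A$, whose last two morphisms are the adjunction morphisms. **Proposition.** Let $(\mathcal A,\mathcal B,\mathcal C)$ be a recollement of extriangulated categories. Assume that $\mathcal B$ has enough projectives and that $i^!$ and $j_!$ are exact. Let $(\mathcal U_1,\mathcal V_1)$ and $(\mathcal U_3,\mathcal V_3)$ be cotorsion pairs in $\mathcal A$ and $\mathcal C$, respectively. Define $$\widetilde{\mathcal U_2}=\{B\in\mathcal B\mid i^*B\in\mathcal U_1\text{ and }j^*B\in\mathcal U_3\},\qquad \mathcal V_2=\{B\in\mathcal B\mid i^!B\in\mathcal V_1\text{ and }j^*B\in\mathcal V_3\},\qquad \mathcal U_2={}^{\perp_1}\mathcal V_2 .$$ Then $(\mathcal U_2,\mathcal V_2)$ is a cotorsion pair in $\mathcal B$, and $\mathcal U_2\subseteq\mathsf{add}\,\widetilde{\mathcal U_2}$. -/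

import Mathlib

open CategoryTheory CategoryTheory.Limits Opposite

universe w w₁ w₂ w₃ v v₁ v₂ v₃ u u₁ u₂ u₃

noncomputable section

namespace Extri

attribute [local instance] hasBinaryBiproducts_of_finite_biproducts

/-! ### Extriangulated categories -/

section Bifunctor

variable {C : Type u} [Category.{v} C]

/-- The group `𝔼(Z, X)` of a bifunctor `𝔼 : Cᵒᵖ × C → Ab`; its elements are called extensions. -/
abbrev ExtGroup (E : Cᵒᵖ ⥤ C ⥤ AddCommGrpCat.{w}) (Z X : C) : Type w :=
  (E.obj (op Z)).obj X

/-- Covariant action: `a_* δ ∈ 𝔼(Z, X')` for `δ ∈ 𝔼(Z, X)` and `a : X ⟶ X'`. -/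
def push (E : Cᵒᵖ ⥤ C ⥤ AddCommGrpCat.{w}) {Z X X' : C} (a : X ⟶ X')
    (δ : ExtGroup E Z X) : ExtGroup E Z X' :=
  ((E.obj (op Z)).map a).hom δ

/-- Contravariant action: `c^* δ ∈ 𝔼(Z', X)` for `δ ∈ 𝔼(Z, X)` and `c : Z' ⟶ Z`. -/
def pull (E : Cᵒᵖ ⥤ C ⥤ AddCommGrpCat.{w}) {Z' Z X : C} (c : Z' ⟶ Z)
    (δ : ExtGroup E Z X) : ExtGroup E Z' X :=
  ((E.map c.op).app X).hom δ

/-- Equivalence of two sequences `X ⟶ Y ⟶ Z` and `X ⟶ Y' ⟶ Z` with the same end terms. -/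
def SeqEquiv {X Y Y' Z : C} (x : X ⟶ Y) (y : Y ⟶ Z) (x' : X ⟶ Y') (y' : Y' ⟶ Z) : Prop :=
  ∃ e : Y ≅ Y', x ≫ e.hom = x' ∧ e.hom ≫ y' = y

end Bifunctor

/-- An extriangulated structure `(𝔼, 𝔰)` (Nakaoka--Palu) on an additive category `C`.
The realization `𝔰`, which sends `δ ∈ 𝔼(Z, X)` to an equivalence class of sequences
`X ⟶ Y ⟶ Z`, is encoded by the membership relation `Realizes δ x y`, that is,
`𝔰(δ) = [X --x--> Y --y--> Z]`. -/
structure ExtStructure (C : Type u) [Category.{v} C] [Preadditive C] [HasFiniteBiproducts C] where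
  /-- (ET1): the biadditive functor `𝔼`. -/
  E : Cᵒᵖ ⥤ C ⥤ AddCommGrpCat.{w}
  additive_left : E.Additive
  additive_right : ∀ Z : Cᵒᵖ, (E.obj Z).Additive
  Realizes : ∀ {X Y Z : C}, ExtGroup E Z X → (X ⟶ Y) → (Y ⟶ Z) → Prop
  /-- For every `δ` the sequences realizing `δ` form exactly one equivalence class. -/
  exists_realizes : ∀ {X Z : C} (δ : ExtGroup E Z X),
    ∃ (Y : C) (x : X ⟶ Y) (y : Y ⟶ Z), Realizes δ x y
  realizes_iff : ∀ {X Y Y' Z : C} {δ : ExtGroup E Z X} {x : X ⟶ Y} {y : Y ⟶ Z}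
    (x' : X ⟶ Y') (y' : Y' ⟶ Z), Realizes δ x y → (Realizes δ x' y' ↔ SeqEquiv x y x' y')
  /-- (ET2): every morphism of extensions lifts to the realizations. -/
  exists_middle : ∀ {X Y Z X' Y' Z' : C} {δ : ExtGroup E Z X} {δ' : ExtGroup E Z' X'}
    {x : X ⟶ Y} {y : Y ⟶ Z} {x' : X' ⟶ Y'} {y' : Y' ⟶ Z'},
    Realizes δ x y → Realizes δ' x' y' → ∀ (a : X ⟶ X') (c : Z ⟶ Z'),
      push E a δ = pull E c δ' → ∃ b : Y ⟶ Y', x ≫ b = a ≫ x' ∧ y ≫ c = b ≫ y'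
  /-- (ET2): the zero extension is realized by the split sequence. -/
  realizes_zero : ∀ X Z : C,
    Realizes (0 : ExtGroup E Z X) (biprod.inl : X ⟶ X ⊞ Z) (biprod.snd : X ⊞ Z ⟶ Z)
  /-- (ET2): `δ ⊕ δ'` is realized by the direct sum of realizations. -/
  realizes_biprod : ∀ {X Y Z X' Y' Z' : C} {δ : ExtGroup E Z X} {δ' : ExtGroup E Z' X'}
    {x : X ⟶ Y} {y : Y ⟶ Z} {x' : X' ⟶ Y'} {y' : Y' ⟶ Z'},
    Realizes δ x y → Realizes δ' x' y' →
      Realizes (push E (biprod.inl : X ⟶ X ⊞ X') (pull E (biprod.fst : Z ⊞ Z' ⟶ Z) δ) +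
          push E (biprod.inr : X' ⟶ X ⊞ X') (pull E (biprod.snd : Z ⊞ Z' ⟶ Z') δ'))
        (biprod.map x x') (biprod.map y y')
  /-- (ET3) -/
  et3 : ∀ {X Y Z X' Y' Z' : C} {δ : ExtGroup E Z X} {δ' : ExtGroup E Z' X'}
    {x : X ⟶ Y} {y : Y ⟶ Z} {x' : X' ⟶ Y'} {y' : Y' ⟶ Z'},
    Realizes δ x y → Realizes δ' x' y' → ∀ (a : X ⟶ X') (b : Y ⟶ Y'), x ≫ b = a ≫ x' →
      ∃ c : Z ⟶ Z', y ≫ c = b ≫ y' ∧ push E a δ = pull E c δ'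
  /-- (ET3)ᵒᵖ -/
  et3_op : ∀ {X Y Z X' Y' Z' : C} {δ : ExtGroup E Z X} {δ' : ExtGroup E Z' X'}
    {x : X ⟶ Y} {y : Y ⟶ Z} {x' : X' ⟶ Y'} {y' : Y' ⟶ Z'},
    Realizes δ x y → Realizes δ' x' y' → ∀ (b : Y ⟶ Y') (c : Z ⟶ Z'), y ≫ c = b ≫ y' →
      ∃ a : X ⟶ X', x ≫ b = a ≫ x' ∧ push E a δ = pull E c δ'
  /-- (ET4) -/
  et4 : ∀ {A B C' D F : C} {f : A ⟶ B} {f' : B ⟶ D} {g : B ⟶ C'} {g' : C' ⟶ F}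
    {δ : ExtGroup E D A} {δ' : ExtGroup E F B}, Realizes δ f f' → Realizes δ' g g' →
      ∃ (G : C) (h' : C' ⟶ G) (d : D ⟶ G) (e : G ⟶ F) (δ'' : ExtGroup E G A),
        Realizes δ'' (f ≫ g) h' ∧ f' ≫ d = g ≫ h' ∧ h' ≫ e = g' ∧
        Realizes (push E f' δ') d e ∧ pull E d δ'' = δ ∧ push E f δ'' = pull E e δ'
  /-- (ET4)ᵒᵖ -/
  et4_op : ∀ {A B C' D F : C} {f' : D ⟶ B} {f : B ⟶ A} {g' : F ⟶ C'} {g : C' ⟶ B}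
    {δ : ExtGroup E A D} {δ' : ExtGroup E B F}, Realizes δ f' f → Realizes δ' g' g →
      ∃ (G : C) (h' : G ⟶ C') (d : G ⟶ D) (e : F ⟶ G) (δ'' : ExtGroup E A G),
        Realizes δ'' h' (g ≫ f) ∧ d ≫ f' = h' ≫ g ∧ e ≫ h' = g' ∧
        Realizes (pull E f' δ') e d ∧ push E d δ'' = δ ∧ pull E f δ'' = push E e δ'

namespace ExtStructure

variable {C : Type u} [Category.{v} C] [Preadditive C] [HasFiniteBiproducts C]
  (S : ExtStructure.{w} C)

/-- The group `𝔼(Z, X)` of the extriangulated structure. -/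
abbrev Ext (Z X : C) : Type w := ExtGroup S.E Z X

/-- `X --x--> Y --y--> Z ⇢` is an `𝔼`-triangle, for some extension. -/
def IsTriangle {X Y Z : C} (x : X ⟶ Y) (y : Y ⟶ Z) : Prop :=
  ∃ δ : S.Ext Z X, S.Realizes δ x y

def IsInflation {X Y : C} (x : X ⟶ Y) : Prop :=
  ∃ (Z : C) (y : Y ⟶ Z), S.IsTriangle x y

def IsDeflation {Y Z : C} (y : Y ⟶ Z) : Prop :=
  ∃ (X : C) (x : X ⟶ Y), S.IsTriangle x y

/-- Condition (WIC). -/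
structure WIC : Prop where
  deflation : ∀ {X Y Z : C} (f : X ⟶ Y) (g : Y ⟶ Z), S.IsDeflation (f ≫ g) → S.IsDeflation g
  inflation : ∀ {X Y Z : C} (f : X ⟶ Y) (g : Y ⟶ Z), S.IsInflation (f ≫ g) → S.IsInflation f

/-- `P` is projective: morphisms from `P` lift along the deflation of any `𝔼`-triangle. -/
def IsProjective (P : C) : Prop :=
  ∀ {X Y Z : C} (x : X ⟶ Y) (y : Y ⟶ Z), S.IsTriangle x y →
    ∀ c : P ⟶ Z, ∃ b : P ⟶ Y, b ≫ y = c

/-- There are enough projectives: every `Z` has an `𝔼`-triangle `K ⟶ P ⟶ Z ⇢` with `P`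
projective. -/
def EnoughProjectives : Prop :=
  ∀ Z : C, ∃ (K P : C) (x : K ⟶ P) (y : P ⟶ Z), S.IsProjective P ∧ S.IsTriangle x y

/-- `f` is compatible: if `f` is both an inflation and a deflation, then it is an isomorphism. -/
def IsCompatible {X Y : C} (f : X ⟶ Y) : Prop :=
  S.IsInflation f → S.IsDeflation f → IsIso f

/-- The sequence `X --f--> Y --g--> Z` is right exact. -/
def IsRightExactSeq {X Y Z : C} (f : X ⟶ Y) (g : Y ⟶ Z) : Prop :=
  ∃ (K : C) (h₁ : X ⟶ K) (h₂ : K ⟶ Y), S.IsTriangle h₂ g ∧ S.IsDeflation h₁ ∧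
    S.IsCompatible h₁ ∧ h₁ ≫ h₂ = f

/-- The sequence `X --f--> Y --g--> Z` is left exact. -/
def IsLeftExactSeq {X Y Z : C} (f : X ⟶ Y) (g : Y ⟶ Z) : Prop :=
  ∃ (K : C) (h₁ : Y ⟶ K) (h₂ : K ⟶ Z), S.IsTriangle f h₁ ∧ S.IsInflation h₂ ∧
    S.IsCompatible h₂ ∧ h₁ ≫ h₂ = g

/-- The four-term sequence `W --f--> X --g--> Y --h--> Z` is a right exact `𝔼`-triangle
sequence. -/
def IsRightExactSeq₄ {W X Y Z : C} (f : W ⟶ X) (g : X ⟶ Y) (h : Y ⟶ Z) : Prop :=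
  ∃ (K : C) (g₁ : X ⟶ K) (g₂ : K ⟶ Y), S.IsTriangle f g₁ ∧ S.IsTriangle g₂ h ∧
    g₁ ≫ g₂ = g ∧ S.IsCompatible g₁

/-- The four-term sequence `W --f--> X --g--> Y --h--> Z` is a left exact `𝔼`-triangle
sequence. -/
def IsLeftExactSeq₄ {W X Y Z : C} (f : W ⟶ X) (g : X ⟶ Y) (h : Y ⟶ Z) : Prop :=
  ∃ (K : C) (g₁ : X ⟶ K) (g₂ : K ⟶ Y), S.IsTriangle f g₁ ∧ S.IsTriangle g₂ h ∧
    g₁ ≫ g₂ = g ∧ S.IsCompatible g₂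

/-- The convention for (full) subcategories: closed under isomorphisms, direct sums and direct
summands. -/
structure IsSubcategory (P : ObjectProperty C) : Prop where
  of_iso : ∀ {X Y : C}, (X ≅ Y) → P X → P Y
  biprod : ∀ {X Y : C}, P X → P Y → P (X ⊞ Y)
  summand : ∀ {X Y : C}, P (X ⊞ Y) → P X

/-- `(U, V)` is a cotorsion pair. -/
structure IsCotorsionPair (U V : ObjectProperty C) : Prop where
  left : IsSubcategory U
  right : IsSubcategory V
  ext_eq_zero : ∀ {X Y : C}, U X → V Y → ∀ δ : S.Ext X Y, δ = 0
  exists_left : ∀ B : C, ∃ (V₀ U₀ : C) (x : V₀ ⟶ U₀) (y : U₀ ⟶ B),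
    V V₀ ∧ U U₀ ∧ S.IsTriangle x y
  exists_right : ∀ B : C, ∃ (V₀ U₀ : C) (x : B ⟶ V₀) (y : V₀ ⟶ U₀),
    V V₀ ∧ U U₀ ∧ S.IsTriangle x y

/-- `^{⊥₁} V`: the objects `X` with `𝔼(X, V) = 0`. -/
def leftPerp (V : ObjectProperty C) : ObjectProperty C :=
  fun X => ∀ Y : C, V Y → ∀ δ : S.Ext X Y, δ = 0

end ExtStructure

/-- `add P`: the direct summands of finite direct sums of objects of `P`. -/
def addClosure {C : Type u} [Category.{v} C] [Preadditive C] [HasFiniteBiproducts C]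
    (P : ObjectProperty C) : ObjectProperty C :=
  fun X => ∃ (n : ℕ) (f : Fin n → C) (Y : C), (∀ k, P (f k)) ∧ Nonempty (X ⊞ Y ≅ ⨁ f)

/-! ### Exact functors -/

section Functors

variable {C : Type u₁} [Category.{v₁} C] [Preadditive C] [HasFiniteBiproducts C]
  {D : Type u₂} [Category.{v₂} D] [Preadditive D] [HasFiniteBiproducts D]

/-- `F` is an exact functor: it is additive, preserves compatible morphisms, and there is a natural
transformation `η : 𝔼_C(-, -) ⟶ 𝔼_D(F -, F -)` such that `𝔰(δ) = [X ⟶ Y ⟶ Z]` implies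
`𝔰(η δ) = [F X ⟶ F Y ⟶ F Z]`. -/
structure IsExact (S : ExtStructure.{w₁} C) (T : ExtStructure.{w₂} D) (F : C ⥤ D) : Prop where
  additive : F.Additive
  compatible : ∀ {X Y : C} (f : X ⟶ Y), S.IsCompatible f → T.IsCompatible (F.map f)
  exists_eta : ∃ η : ∀ Z X : C, S.Ext Z X →+ T.Ext (F.obj Z) (F.obj X),
    (∀ {Z X X' : C} (a : X ⟶ X') (δ : S.Ext Z X),
      η Z X' (push S.E a δ) = push T.E (F.map a) (η Z X δ)) ∧
    (∀ {Z' Z X : C} (c : Z' ⟶ Z) (δ : S.Ext Z X),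
      η Z' X (pull S.E c δ) = pull T.E (F.map c) (η Z X δ)) ∧
    (∀ {X Y Z : C} (δ : S.Ext Z X) (x : X ⟶ Y) (y : Y ⟶ Z), S.Realizes δ x y →
      T.Realizes (η Z X δ) (F.map x) (F.map y))

/-- `F` is a right exact functor. In `exists_eta`, `A' δ` is the object through which `F` of the
inflation of a triangle with extension `δ` factors (by a compatible deflation `q δ`); it depends on
`δ`, so that naturality of `η` refers to morphisms `(a, c) : δ ⟶ δ'` of extensions. -/
structure IsRightExact (S : ExtStructure.{w₁} C) (T : ExtStructure.{w₂} D) (F : C ⥤ D) :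
    Prop where
  additive : F.Additive
  compatible : ∀ {X Y : C} (f : X ⟶ Y), S.IsCompatible f → T.IsCompatible (F.map f)
  rightExactSeq : ∀ {X Y Z : C} (f : X ⟶ Y) (g : Y ⟶ Z), S.IsRightExactSeq f g →
    T.IsRightExactSeq (F.map f) (F.map g)
  exists_eta : ∃ (A' : ∀ {Z X : C}, S.Ext Z X → D)
    (q : ∀ {Z X : C} (δ : S.Ext Z X), F.obj X ⟶ A' δ)
    (η : ∀ {Z X : C} (δ : S.Ext Z X), T.Ext (F.obj Z) (A' δ)),
    (∀ {Z X : C} (δ : S.Ext Z X), T.IsDeflation (q δ) ∧ T.IsCompatible (q δ)) ∧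
    (∀ {X Y Z : C} (δ : S.Ext Z X) (x : X ⟶ Y) (y : Y ⟶ Z), S.Realizes δ x y →
      ∃ x' : A' δ ⟶ F.obj Y, q δ ≫ x' = F.map x ∧ T.Realizes (η δ) x' (F.map y)) ∧
    (∀ {X Z X' Z' : C} (δ : S.Ext Z X) (δ' : S.Ext Z' X') (a : X ⟶ X') (c : Z ⟶ Z'),
      push S.E a δ = pull S.E c δ' → ∃ a' : A' δ ⟶ A' δ', q δ ≫ a' = F.map a ≫ q δ' ∧
        push T.E a' (η δ) = pull T.E (F.map c) (η δ'))

/-- `F` is a left exact functor (the dual notion). -/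
structure IsLeftExact (S : ExtStructure.{w₁} C) (T : ExtStructure.{w₂} D) (F : C ⥤ D) :
    Prop where
  additive : F.Additive
  compatible : ∀ {X Y : C} (f : X ⟶ Y), S.IsCompatible f → T.IsCompatible (F.map f)
  leftExactSeq : ∀ {X Y Z : C} (f : X ⟶ Y) (g : Y ⟶ Z), S.IsLeftExactSeq f g →
    T.IsLeftExactSeq (F.map f) (F.map g)
  exists_eta : ∃ (C' : ∀ {Z X : C}, S.Ext Z X → D)
    (m : ∀ {Z X : C} (δ : S.Ext Z X), C' δ ⟶ F.obj Z)
    (η : ∀ {Z X : C} (δ : S.Ext Z X), T.Ext (C' δ) (F.obj X)),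
    (∀ {Z X : C} (δ : S.Ext Z X), T.IsInflation (m δ) ∧ T.IsCompatible (m δ)) ∧
    (∀ {X Y Z : C} (δ : S.Ext Z X) (x : X ⟶ Y) (y : Y ⟶ Z), S.Realizes δ x y →
      ∃ y' : F.obj Y ⟶ C' δ, y' ≫ m δ = F.map y ∧ T.Realizes (η δ) (F.map x) y') ∧
    (∀ {X Z X' Z' : C} (δ : S.Ext Z X) (δ' : S.Ext Z' X') (a : X ⟶ X') (c : Z ⟶ Z'),
      push S.E a δ = pull S.E c δ' → ∃ c' : C' δ ⟶ C' δ', c' ≫ m δ' = m δ ≫ F.map c ∧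
        push T.E (F.map a) (η δ) = pull T.E c' (η δ'))

end Functors

/-! ### Recollements -/

/-- A recollement `(A, B, C)` of extriangulated categories. Names of the functors:
`iStar = i_*`, `iUpper = i^*`, `iShriek = i^!`, `jUpper = j^*`, `jShriek = j_!`, `jStar = j_*`. -/
structure Recollement {A : Type u₁} [Category.{v₁} A] [Preadditive A] [HasFiniteBiproducts A]
    {B : Type u₂} [Category.{v₂} B] [Preadditive B] [HasFiniteBiproducts B]
    {C : Type u₃} [Category.{v₃} C] [Preadditive C] [HasFiniteBiproducts C]
    (SA : ExtStructure.{w₁} A) (SB : ExtStructure.{w₂} B) (SC : ExtStructure.{w₃} C) where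
  iStar : A ⥤ B
  iUpper : B ⥤ A
  iShriek : B ⥤ A
  jUpper : B ⥤ C
  jShriek : C ⥤ B
  jStar : C ⥤ B
  iStar_exact : IsExact SA SB iStar
  jUpper_exact : IsExact SB SC jUpper
  iUpper_rightExact : IsRightExact SB SA iUpper
  jShriek_rightExact : IsRightExact SC SB jShriek
  iShriek_leftExact : IsLeftExact SB SA iShriek
  jStar_leftExact : IsLeftExact SC SB jStar
  /-- (R1) -/
  iUpperAdj : iUpper ⊣ iStar
  iShriekAdj : iStar ⊣ iShriek
  jShriekAdj : jShriek ⊣ jUpper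
  jStarAdj : jUpper ⊣ jStar
  /-- (R2) -/
  essImage_iff : ∀ X : B, iStar.essImage X ↔ IsZero (jUpper.obj X)
  /-- (R3) -/
  iStar_full : iStar.Full
  iStar_faithful : iStar.Faithful
  jShriek_full : jShriek.Full
  jShriek_faithful : jShriek.Faithful
  jStar_full : jStar.Full
  jStar_faithful : jStar.Faithful
  /-- (R4) -/
  leftExactSeq : ∀ X : B, ∃ (Q : A) (h : jStar.obj (jUpper.obj X) ⟶ iStar.obj Q),
    SB.IsLeftExactSeq₄ (iShriekAdj.counit.app X) (jStarAdj.unit.app X) h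
  /-- (R5) -/
  rightExactSeq : ∀ X : B, ∃ (Q : A) (h : iStar.obj Q ⟶ jShriek.obj (jUpper.obj X)),
    SB.IsRightExactSeq₄ h (jShriekAdj.counit.app X) (iUpperAdj.unit.app X)

namespace Recollement

variable {A : Type u₁} [Category.{v₁} A] [Preadditive A] [HasFiniteBiproducts A]
  {B : Type u₂} [Category.{v₂} B] [Preadditive B] [HasFiniteBiproducts B]
  {C : Type u₃} [Category.{v₃} C] [Preadditive C] [HasFiniteBiproducts C]
  {SA : ExtStructure.{w₁} A} {SB : ExtStructure.{w₂} B} {SC : ExtStructure.{w₃} C}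

/-- The objects `X` of `B` with `i^* X ∈ U₁` and `j^* X ∈ U₃`. -/
def gluedLeft (R : Recollement SA SB SC) (U₁ : ObjectProperty A) (U₃ : ObjectProperty C) :
    ObjectProperty B :=
  fun X => U₁ (R.iUpper.obj X) ∧ U₃ (R.jUpper.obj X)

/-- The objects `X` of `B` with `i^! X ∈ V₁` and `j^* X ∈ V₃`. -/
def gluedRight (R : Recollement SA SB SC) (V₁ : ObjectProperty A) (V₃ : ObjectProperty C) :
    ObjectProperty B :=
  fun X => V₁ (R.iShriek.obj X) ∧ V₃ (R.jUpper.obj X)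

end Recollement

end Extri

end

noncomputable section

namespace Extri

attribute [local instance] hasBinaryBiproducts_of_finite_biproducts

section Bifunctor

variable {C : Type u} [Category.{v} C] (E : Cᵒᵖ ⥤ C ⥤ AddCommGrpCat.{w})

lemma push_zero {Z X X' : C} (a : X ⟶ X') : push E a (0 : ExtGroup E Z X) = 0 :=
  map_zero _

lemma pull_zero {Z' Z X : C} (c : Z' ⟶ Z) : pull E c (0 : ExtGroup E Z X) = 0 :=
  map_zero _

lemma pull_add {Z' Z X : C} (c : Z' ⟶ Z) (δ δ' : ExtGroup E Z X) :
    pull E c (δ + δ') = pull E c δ + pull E c δ' :=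
  map_add _ _ _

lemma push_id {Z X : C} (δ : ExtGroup E Z X) : push E (𝟙 X) δ = δ := by
  simp [push]

lemma pull_id {Z X : C} (δ : ExtGroup E Z X) : pull E (𝟙 Z) δ = δ := by
  simp [pull]

lemma push_push {Z X X' X'' : C} (a : X ⟶ X') (a' : X' ⟶ X'') (δ : ExtGroup E Z X) :
    push E a' (push E a δ) = push E (a ≫ a') δ := by
  simp [push]

lemma pull_pull {Z'' Z' Z X : C} (c' : Z'' ⟶ Z') (c : Z' ⟶ Z) (δ : ExtGroup E Z X) :
    pull E c' (pull E c δ) = pull E (c' ≫ c) δ := by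
  simp [pull]

lemma push_pull {Z' Z X X' : C} (a : X ⟶ X') (c : Z' ⟶ Z) (δ : ExtGroup E Z X) :
    push E a (pull E c δ) = pull E c (push E a δ) := by
  exact (ConcreteCategory.congr_hom ((E.map c.op).naturality a) δ).symm

end Bifunctor

namespace ExtStructure

variable {C : Type u} [Category.{v} C] [Preadditive C] [HasFiniteBiproducts C]
  (S : ExtStructure.{w} C)

lemma pull_zero_hom {Z' Z X : C} (δ : S.Ext Z X) : pull S.E (0 : Z' ⟶ Z) δ = 0 := by
  have := S.additive_left
  have h : S.E.map (0 : Z' ⟶ Z).op = 0 := by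
    rw [op_zero]; exact S.E.map_zero _ _
  simp only [pull, h]
  rfl

lemma ext_eq_zero_of_isZero {Z X : C} (hZ : IsZero Z) (δ : S.Ext Z X) : δ = 0 := by
  rw [← pull_id S.E δ, hZ.eq_of_src (𝟙 Z) 0, pull_zero_hom]

variable {S}

lemma realizes_of_isZero_left {T : C} (hT : IsZero T) (Y : C) :
    S.Realizes (0 : S.Ext Y T) (0 : T ⟶ Y) (𝟙 Y) :=
  (S.realizes_iff _ _ (S.realizes_zero T Y)).2
    ⟨⟨biprod.snd, biprod.inr, by ext <;> simp [hT.eq_of_tgt _ (0 : _ ⟶ T)], by simp⟩,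
      by simp, by simp⟩

lemma realizes_of_isZero_right {T : C} (hT : IsZero T) (Y : C) :
    S.Realizes (0 : S.Ext T Y) (𝟙 Y) (0 : Y ⟶ T) :=
  (S.realizes_iff _ _ (S.realizes_zero Y T)).2
    ⟨⟨biprod.fst, biprod.inl, by ext <;> simp [hT.eq_of_tgt _ (0 : _ ⟶ T)], by simp⟩,
      by simp, hT.eq_of_tgt _ _⟩

section Triangle

variable {X Y Z : C} {δ : S.Ext Z X} {x : X ⟶ Y} {y : Y ⟶ Z}

lemma Realizes.pull_eq_zero (h : S.Realizes δ x y) : pull S.E y δ = 0 := by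
  obtain ⟨a, -, ha⟩ := S.et3_op (realizes_of_isZero_left (isZero_zero C) Y) h (𝟙 Y) y rfl
  rw [← ha, push_zero]

lemma Realizes.push_eq_zero (h : S.Realizes δ x y) : push S.E x δ = 0 := by
  obtain ⟨c, -, hc⟩ := S.et3 h (realizes_of_isZero_right (isZero_zero C) Y) x (𝟙 Y) rfl
  rw [hc, pull_zero]

/-- A morphism pulling the extension back to zero lifts along the deflation. -/
lemma Realizes.exists_lift (h : S.Realizes δ x y) {P : C} (c : P ⟶ Z)
    (hc : pull S.E c δ = 0) : ∃ b : P ⟶ Y, b ≫ y = c := by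
  obtain ⟨b, -, hb⟩ := S.exists_middle (realizes_of_isZero_left (isZero_zero C) P) h 0 c
    (by rw [push_zero, hc])
  exact ⟨b, by rw [← hb, Category.id_comp]⟩

/-- A morphism vanishing on the inflation factors through the deflation. -/
lemma Realizes.exists_desc (h : S.Realizes δ x y) {T : C} (n : Y ⟶ T) (hn : x ≫ n = 0) :
    ∃ s : Z ⟶ T, y ≫ s = n := by
  obtain ⟨s, hs, -⟩ := S.et3 h (realizes_of_isZero_left (isZero_zero C) T) 0 n (by simp [hn])
  exact ⟨s, by rw [hs, Category.comp_id]⟩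

lemma Realizes.eq_zero_of_section (h : S.Realizes δ x y) (s : Z ⟶ Y) (hs : s ≫ y = 𝟙 Z) :
    δ = 0 := by
  rw [← pull_id S.E δ, ← hs, ← pull_pull, h.pull_eq_zero, pull_zero]

lemma Realizes.exists_iso_biprod (h : S.Realizes δ x y) (hδ : δ = 0) :
    ∃ e : X ⊞ Z ≅ Y, biprod.inl ≫ e.hom = x ∧ e.hom ≫ y = biprod.snd := by
  subst hδ
  exact (S.realizes_iff _ _ (S.realizes_zero X Z)).1 h

lemma Realizes.isZero_of_isIso (h : S.Realizes δ x y) [IsIso x] : IsZero Z := by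
  have hδ : δ = 0 := by
    rw [← push_id S.E δ, ← IsIso.hom_inv_id x, ← push_push, h.push_eq_zero, push_zero]
  obtain ⟨e, he, -⟩ := h.exists_iso_biprod hδ
  have hi : (biprod.inl : X ⟶ X ⊞ Z) = x ≫ e.inv := by simp [← he]
  have : IsIso (biprod.inl : X ⟶ X ⊞ Z) := by rw [hi]; infer_instance
  have hs : (biprod.snd : X ⊞ Z ⟶ Z) = 0 := by
    rw [← cancel_epi (biprod.inl : X ⟶ X ⊞ Z)]; simp
  rw [IsZero.iff_id_eq_zero, ← biprod.inr_snd (X := X), hs, comp_zero]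

lemma Realizes.isIso_of_isZero (h : S.Realizes δ x y) (hZ : IsZero Z) : IsIso x := by
  obtain ⟨e, he, -⟩ := h.exists_iso_biprod (S.ext_eq_zero_of_isZero hZ δ)
  have : IsIso (biprod.inl : X ⟶ X ⊞ Z) :=
    ⟨biprod.fst, by simp, by ext <;> simp [hZ.eq_of_tgt _ (0 : _ ⟶ Z)]⟩
  rw [← he]; infer_instance

lemma Realizes.isIso_of_endomorphism (h : S.Realizes δ x y) (b : Y ⟶ Y) (hx : x ≫ b = x)
    (hy : b ≫ y = y) : IsIso b := by
  obtain ⟨s, hs⟩ := h.exists_desc (b - 𝟙 Y) (by simp [hx])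
  have hn : (b - 𝟙 Y) ≫ (b - 𝟙 Y) = 0 := by
    nth_rw 2 [← hs]
    rw [← Category.assoc, Preadditive.sub_comp, hy]
    simp
  have hb : b = 𝟙 Y + (b - 𝟙 Y) := by abel
  generalize b - 𝟙 Y = n at hn hb
  subst hb
  exact ⟨𝟙 Y - n, by simp [hn], by simp [hn]⟩

/-- A morphism of triangles whose extension part is an isomorphism extends to an isomorphism. -/
lemma Realizes.exists_iso (h : S.Realizes δ x y) {X' Y' Z' : C} {δ' : S.Ext Z' X'}
    {x' : X' ⟶ Y'} {y' : Y' ⟶ Z'} (h' : S.Realizes δ' x' y') (a : X ⟶ X') (c : Z ⟶ Z') [IsIso a]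
    [IsIso c] (hδ : push S.E a δ = pull S.E c δ') :
    ∃ e : Y ≅ Y', x ≫ e.hom = a ≫ x' ∧ y ≫ c = e.hom ≫ y' := by
  have hδ' : push S.E (inv a) δ' = pull S.E (inv c) δ := by
    have := congrArg (fun ε => push S.E (inv a) (pull S.E (inv c) ε)) hδ
    simp only [pull_pull, IsIso.inv_hom_id, pull_id] at this
    rw [← this, push_pull, push_push, IsIso.hom_inv_id, push_id]
  obtain ⟨b, hb, hb'⟩ := S.exists_middle h h' a c hδ
  obtain ⟨d, hd, hd'⟩ := S.exists_middle h' h (inv a) (inv c) hδ'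
  have h₁ : IsIso (b ≫ d) := h.isIso_of_endomorphism _
    (by rw [← Category.assoc, hb, Category.assoc, hd, IsIso.hom_inv_id_assoc])
    (by rw [Category.assoc, ← hd', ← Category.assoc, ← hb', Category.assoc, IsIso.hom_inv_id,
      Category.comp_id])
  have h₂ : IsIso (d ≫ b) := h'.isIso_of_endomorphism _
    (by rw [← Category.assoc, hd, Category.assoc, hb, IsIso.inv_hom_id_assoc])
    (by rw [Category.assoc, ← hb', ← Category.assoc, ← hd', Category.assoc, IsIso.inv_hom_id,
      Category.comp_id])
  have : IsSplitMono b := ⟨⟨⟨d ≫ inv (b ≫ d), by rw [← Category.assoc, IsIso.hom_inv_id]⟩⟩⟩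
  have : Epi b := epi_of_epi d b
  have : IsIso b := isIso_of_epi_of_isSplitMono b
  exact ⟨asIso b, hb, hb'⟩

end Triangle

lemma IsTriangle.isZero_of_isZero {X Y Z : C} {x : X ⟶ Y} {y : Y ⟶ Z} (h : S.IsTriangle x y)
    (hX : IsZero X) (hY : IsZero Y) : IsZero Z := by
  obtain ⟨δ, h⟩ := h
  have : IsIso x := ⟨0, hX.eq_of_src _ _, hY.eq_of_src _ _⟩
  exact h.isZero_of_isIso

lemma IsTriangle.isIso_of_isZero {X Y Z : C} {x : X ⟶ Y} {y : Y ⟶ Z} (h : S.IsTriangle x y)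
    (hZ : IsZero Z) : IsIso x :=
  h.elim fun _ h => h.isIso_of_isZero hZ

lemma IsTriangle.of_iso_middle {X Y Y' Z : C} {x : X ⟶ Y} {y : Y ⟶ Z} (h : S.IsTriangle x y)
    (e : Y ≅ Y') : S.IsTriangle (x ≫ e.hom) (e.inv ≫ y) :=
  h.elim fun δ h => ⟨δ, (S.realizes_iff _ _ h).2 ⟨e, rfl, by simp⟩⟩

lemma IsTriangle.of_iso_ends {X X' Y Z Z' : C} {x : X ⟶ Y} {y : Y ⟶ Z} (h : S.IsTriangle x y)
    (a : X' ≅ X) (c : Z ≅ Z') : S.IsTriangle (a.hom ≫ x) (y ≫ c.hom) := by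
  obtain ⟨δ, h⟩ := h
  obtain ⟨Y', x', y', h'⟩ := S.exists_realizes (push S.E a.inv (pull S.E c.inv δ))
  obtain ⟨e, he, he'⟩ := h.exists_iso h' a.inv c.hom
    (by rw [← push_pull, pull_pull, c.hom_inv_id, pull_id])
  exact ⟨_, (S.realizes_iff _ _ h').2 ⟨e.symm, by simp [← cancel_mono e.hom, he], by simp [he']⟩⟩

lemma IsDeflation.comp_iso {Y Y' Z Z' : C} {y : Y ⟶ Z} (h : S.IsDeflation y) (e : Y' ≅ Y)
    (c : Z ≅ Z') : S.IsDeflation (e.hom ≫ y ≫ c.hom) := by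
  obtain ⟨X, x, h⟩ := h
  exact ⟨X, _, (h.of_iso_ends (Iso.refl X) c).of_iso_middle e.symm⟩

/-- Two triangles with the same first term fit into a square whose parallel cones agree. -/
lemma exists_pushout_square {K P V M W : C} {k : K ⟶ P} {p : P ⟶ M} {k' : K ⟶ V} {p' : V ⟶ W}
    (h : S.IsTriangle k p) (h' : S.IsTriangle k' p') :
    ∃ (E : C) (a : V ⟶ E) (b : E ⟶ M) (c : P ⟶ E) (d : E ⟶ W),
      S.IsTriangle a b ∧ S.IsTriangle c d := by
  obtain ⟨δ, h⟩ := h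
  obtain ⟨δ', h'⟩ := h'
  obtain ⟨E, e, g, hE⟩ := S.exists_realizes
    (pull S.E (biprod.fst : M ⊞ W ⟶ M) δ + pull S.E (biprod.snd : M ⊞ W ⟶ W) δ')
  have hr : S.Realizes (0 : S.Ext M W) (biprod.inr : W ⟶ M ⊞ W) biprod.fst :=
    (S.realizes_iff _ _ (S.realizes_zero W M)).2
      ⟨biprod.braiding W M, by ext <;> simp, by simp⟩
  obtain ⟨G, m, d, i, ε, h₁, -, -, h₂, -, -⟩ := S.et4_op (S.realizes_zero M W) hE
  obtain ⟨G', m', d', i', ε', h₁', -, -, h₂', -, -⟩ := S.et4_op hr hE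
  rw [pull_add, pull_pull, pull_pull, biprod.inl_fst, biprod.inl_snd, pull_id, pull_zero_hom,
    add_zero] at h₂
  rw [pull_add, pull_pull, pull_pull, biprod.inr_fst, biprod.inr_snd, pull_id, pull_zero_hom,
    zero_add] at h₂'
  obtain ⟨e₁, -, -⟩ := (S.realizes_iff _ _ h).1 h₂
  obtain ⟨e₂, -, -⟩ := (S.realizes_iff _ _ h').1 h₂'
  exact ⟨E, _, _, _, _, IsTriangle.of_iso_ends ⟨_, h₁'⟩ e₂ (Iso.refl M),
    IsTriangle.of_iso_ends ⟨_, h₁⟩ e₁ (Iso.refl W)⟩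

lemma IsProjective.ext_eq_zero {P : C} (hP : S.IsProjective P) {X : C} (δ : S.Ext P X) :
    δ = 0 := by
  obtain ⟨Y, x, y, h⟩ := S.exists_realizes δ
  obtain ⟨s, hs⟩ := hP x y ⟨δ, h⟩ (𝟙 P)
  exact h.eq_zero_of_section s hs

lemma IsSubcategory.of_isZero {V : ObjectProperty C} (h : IsSubcategory V) {X Z : C} (hX : V X)
    (hZ : IsZero Z) : V Z :=
  h.summand (h.of_iso (X := X) (Y := Z ⊞ X)
    ⟨biprod.inr, biprod.snd, by simp, by ext <;> simp [hZ.eq_of_src _ (0 : Z ⟶ _)]⟩ hX)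

open scoped ZeroObject in
lemma le_addClosure (P : ObjectProperty C) : P ≤ addClosure P := fun X hX =>
  ⟨1, fun _ => X, 0, fun _ => hX,
    ⟨⟨biprod.fst, biprod.inl, by ext; simp, by simp⟩ ≪≫
      (biproductUniqueIso fun _ : Fin 1 => X).symm⟩⟩

section Perp

variable (V : ObjectProperty C)

lemma leftPerp_of_isTriangle {X W Z : C} {x : X ⟶ W} {z : W ⟶ Z} (h : S.IsTriangle x z)
    (hX : S.leftPerp V X) (hZ : S.leftPerp V Z) : S.leftPerp V W := by
  obtain ⟨ε, h⟩ := h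
  intro Y hY δ
  obtain ⟨M, m, n, hM⟩ := S.exists_realizes δ
  obtain ⟨G, h', d, e, δ'', -, -, -, hG, -, hδ⟩ := S.et4_op h hM
  obtain ⟨i, hi, -⟩ := hG.exists_iso_biprod (hX Y hY _)
  have hr : e ≫ i.inv ≫ biprod.fst = 𝟙 Y := by simp [← hi]
  have := congrArg (push S.E (i.inv ≫ biprod.fst)) hδ
  rw [push_push, hr, push_id, push_pull, hZ Y hY (push S.E _ δ''), pull_zero] at this
  exact this.symm

lemma leftPerp_isSubcategory : IsSubcategory (S.leftPerp V) where
  of_iso e h Y hY δ := by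
    rw [← pull_id S.E δ, ← e.inv_hom_id, ← pull_pull, h Y hY (pull S.E _ δ), pull_zero]
  biprod {X Z} hX hZ := leftPerp_of_isTriangle V ⟨0, S.realizes_zero X Z⟩ hX hZ
  summand h Y hY δ := by
    rw [← pull_id S.E δ, ← biprod.inl_fst, ← pull_pull, h Y hY (pull S.E _ δ), pull_zero]

end Perp

/-- The left class of a cotorsion pair is the left orthogonal of the right class. -/
lemma IsCotorsionPair.of_leftPerp {U V : ObjectProperty C} (h : S.IsCotorsionPair U V) {X : C}
    (hX : S.leftPerp V X) : U X := by
  obtain ⟨V₀, U₀, x, y, hV, hU, δ, hδ⟩ := h.exists_left X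
  obtain ⟨e, -, -⟩ := hδ.exists_iso_biprod (hX V₀ hV δ)
  exact h.left.summand (h.left.of_iso (e.symm ≪≫ biprod.braiding _ _) hU)

/-- Salce's argument: with enough projectives, the triangles `B ⟶ V ⟶ U` suffice. -/
lemma isCotorsionPair_leftPerp (enough : S.EnoughProjectives) {V : ObjectProperty C}
    (hV : IsSubcategory V)
    (hB : ∀ B : C, ∃ (V₀ U₀ : C) (x : B ⟶ V₀) (y : V₀ ⟶ U₀),
      V V₀ ∧ S.leftPerp V U₀ ∧ S.IsTriangle x y) :
    S.IsCotorsionPair (S.leftPerp V) V where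
  left := leftPerp_isSubcategory V
  right := hV
  ext_eq_zero hX hY δ := hX _ hY δ
  exists_left B := by
    obtain ⟨K, P, k, p, hP, hkp⟩ := enough B
    obtain ⟨V₀, U₀, x, y, hV₀, hU₀, hxy⟩ := hB K
    obtain ⟨E, a, b, c, d, hab, hcd⟩ := exists_pushout_square hkp hxy
    exact ⟨V₀, E, a, b, hV₀,
      leftPerp_of_isTriangle V hcd (fun _ _ δ => hP.ext_eq_zero δ) hU₀, hab⟩
  exists_right := hB

end ExtStructure

open ExtStructure

section Functors

variable {C : Type u₁} [Category.{v₁} C] [Preadditive C] [HasFiniteBiproducts C]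
  {D : Type u₂} [Category.{v₂} D] [Preadditive D] [HasFiniteBiproducts D]
  {S : ExtStructure.{w₁} C} {T : ExtStructure.{w₂} D}

lemma IsExact.isTriangle {F : C ⥤ D} (hF : IsExact S T F) {X Y Z : C} {x : X ⟶ Y} {y : Y ⟶ Z}
    (h : S.IsTriangle x y) : T.IsTriangle (F.map x) (F.map y) := by
  obtain ⟨δ, h⟩ := h
  obtain ⟨η, -, -, hη⟩ := hF.exists_eta
  exact ⟨_, hη δ x y h⟩

lemma IsExact.nonempty_iso_of_push {F : C ⥤ D} (hF : IsExact S T F) {X Y Z X' Y' : C}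
    {δ : S.Ext Z X} {x : X ⟶ Y} {y : Y ⟶ Z} (h : S.Realizes δ x y) (a : X ⟶ X')
    [IsIso (F.map a)] {x' : X' ⟶ Y'} {y' : Y' ⟶ Z} (h' : S.Realizes (push S.E a δ) x' y') :
    Nonempty (F.obj Y ≅ F.obj Y') := by
  obtain ⟨η, hp, -, hη⟩ := hF.exists_eta
  have h'' := hη _ x' y' h'
  rw [hp] at h''
  obtain ⟨e, -, -⟩ := (hη _ _ _ h).exists_iso h'' (F.map a) (𝟙 _) (by rw [pull_id])
  exact ⟨e⟩

/-- If the right adjoint preserves triangles, then `𝔼(L X, Y)` vanishes when `𝔼(X, R Y)` does. -/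
lemma ext_eq_zero_of_adjunction {L : C ⥤ D} {R : D ⥤ C} (adj : L ⊣ R)
    (hR : ∀ {X Y Z : D} {x : X ⟶ Y} {y : Y ⟶ Z}, T.IsTriangle x y →
      S.IsTriangle (R.map x) (R.map y))
    {X : C} {Y : D} (h : ∀ δ : S.Ext X (R.obj Y), δ = 0) (δ : T.Ext (L.obj X) Y) : δ = 0 := by
  obtain ⟨M, m, n, hM⟩ := T.exists_realizes δ
  obtain ⟨ε, hε⟩ := hR ⟨δ, hM⟩
  obtain ⟨b, hb⟩ := hε.exists_lift (adj.unit.app X) (h _)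
  refine hM.eq_zero_of_section ((adj.homEquiv _ _).symm b) ?_
  rw [← adj.homEquiv_naturality_right_symm, hb]
  simp

lemma ExtStructure.IsSubcategory.comap {P : ObjectProperty D} (hP : IsSubcategory P) (F : C ⥤ D)
    [F.Additive] : IsSubcategory (fun X => P (F.obj X)) where
  of_iso e h := hP.of_iso (F.mapIso e) h
  biprod {X Y} hX hY :=
    have := preservesBinaryBiproduct_of_preservesBiproduct F X Y
    hP.of_iso (F.mapBiprod X Y).symm (hP.biprod hX hY)
  summand {X Y} h :=
    have := preservesBinaryBiproduct_of_preservesBiproduct F X Y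
    hP.summand (hP.of_iso (F.mapBiprod X Y) h)

end Functors

namespace Recollement

variable {A : Type u₁} [Category.{v₁} A] [Preadditive A] [HasFiniteBiproducts A]
  {B : Type u₂} [Category.{v₂} B] [Preadditive B] [HasFiniteBiproducts B]
  {C : Type u₃} [Category.{v₃} C] [Preadditive C] [HasFiniteBiproducts C]
  {SA : ExtStructure.{w₁} A} {SB : ExtStructure.{w₂} B} {SC : ExtStructure.{w₃} C}
  (R : Recollement SA SB SC)

lemma isZero_jUpper_iStar (X : A) : IsZero (R.jUpper.obj (R.iStar.obj X)) :=
  (R.essImage_iff _).1 (R.iStar.obj_mem_essImage X)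

lemma isZero_iShriek_jStar (X : C) : IsZero (R.iShriek.obj (R.jStar.obj X)) := by
  rw [IsZero.iff_id_eq_zero]
  apply (R.iShriekAdj.homEquiv _ _).symm.injective
  apply (R.jStarAdj.homEquiv _ _).symm.injective
  exact (R.isZero_jUpper_iStar _).eq_of_src _ _

def iShriekIStarIso (X : A) : R.iShriek.obj (R.iStar.obj X) ≅ X :=
  have := R.iStar_full
  have := R.iStar_faithful
  (asIso (R.iShriekAdj.unit.app X)).symm

def jUpperJShriekIso (X : C) : R.jUpper.obj (R.jShriek.obj X) ≅ X :=
  have := R.jShriek_full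
  have := R.jShriek_faithful
  (asIso (R.jShriekAdj.unit.app X)).symm

lemma isIso_jStarAdj_counit (X : C) : IsIso (R.jStarAdj.counit.app X) :=
  have := R.jStar_full
  have := R.jStar_faithful
  inferInstance

lemma isIso_iShriek_map_counit (X : B) : IsIso (R.iShriek.map (R.iShriekAdj.counit.app X)) :=
  have := R.iStar_full
  have := R.iStar_faithful
  inferInstance

lemma isIso_jUpper_map_counit (X : B) : IsIso (R.jUpper.map (R.jShriekAdj.counit.app X)) :=
  have := R.jShriek_full
  have := R.jShriek_faithful
  inferInstance

lemma isZero_of_isZero {X : B} (hj : IsZero (R.jUpper.obj X)) (hi : IsZero (R.iShriek.obj X)) :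
    IsZero X := by
  obtain ⟨Y, ⟨e⟩⟩ := (R.essImage_iff X).2 hj
  have := R.iStar_exact.additive
  have hY : IsZero Y := hi.of_iso ((R.iShriekIStarIso Y).symm ≪≫ R.iShriek.mapIso e)
  exact (R.iStar.map_isZero hY).of_iso e.symm

/-- If `i^!` is exact, then so is `j_*`. -/
lemma jStar_isTriangle (wicC : SC.WIC) (iShriek_exact : IsExact SB SA R.iShriek) {X Y Z : C}
    {x : X ⟶ Y} {y : Y ⟶ Z} (h : SC.IsTriangle x y) :
    SB.IsTriangle (R.jStar.map x) (R.jStar.map y) := by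
  obtain ⟨δ, h⟩ := h
  obtain ⟨C', m, η, hm, hη, -⟩ := R.jStar_leftExact.exists_eta
  obtain ⟨⟨D, d, hD⟩, hc⟩ := hm δ
  obtain ⟨y', hy', h'⟩ := hη δ x y h
  have hj := R.jUpper_exact.isTriangle hD
  have hyd : SC.IsDeflation (R.jUpper.map y' ≫ R.jUpper.map (m δ)) := by
    have := R.isIso_jStarAdj_counit Y
    have := R.isIso_jStarAdj_counit Z
    have e : R.jUpper.map (R.jStar.map y) =
        R.jStarAdj.counit.app Y ≫ y ≫ inv (R.jStarAdj.counit.app Z) := by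
      have := R.jStarAdj.counit_naturality y
      exact ((IsIso.eq_comp_inv _).2 this).trans (Category.assoc _ _ _)
    rw [← R.jUpper.map_comp, hy', e]
    exact IsDeflation.comp_iso ⟨_, _, _, h⟩ (asIso (R.jStarAdj.counit.app Y))
      (asIso (R.jStarAdj.counit.app Z)).symm
  have := R.jUpper_exact.compatible _ hc ⟨_, _, hj⟩ (wicC.deflation _ _ hyd)
  have hjD : IsZero (R.jUpper.obj D) := hj.elim fun _ hj => hj.isZero_of_isIso
  have hiC := (iShriek_exact.isTriangle ⟨_, h'⟩).isZero_of_isZero (R.isZero_iShriek_jStar X)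
    (R.isZero_iShriek_jStar Y)
  have hiD := (iShriek_exact.isTriangle hD).isZero_of_isZero hiC (R.isZero_iShriek_jStar Z)
  have := hD.isIso_of_isZero (R.isZero_of_isZero hjD hiD)
  have := IsTriangle.of_iso_ends ⟨_, h'⟩ (Iso.refl _) (asIso (m δ))
  simpa [hy'] using this

variable {V₁ : ObjectProperty A} {V₃ : ObjectProperty C}

lemma gluedRight_isSubcategory (h₁ : IsSubcategory V₁) (h₃ : IsSubcategory V₃) :
    IsSubcategory (R.gluedRight V₁ V₃) := by
  have := R.iShriek_leftExact.additive
  have := R.jUpper_exact.additive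
  have h₁ := h₁.comap R.iShriek
  have h₃ := h₃.comap R.jUpper
  exact ⟨fun e h => ⟨h₁.of_iso e h.1, h₃.of_iso e h.2⟩,
    fun h h' => ⟨h₁.biprod h.1 h'.1, h₃.biprod h.2 h'.2⟩,
    fun h => ⟨h₁.summand h.1, h₃.summand h.2⟩⟩

lemma gluedRight_iStar (h₁ : IsSubcategory V₁) (h₃ : IsSubcategory V₃) (hV₃ : ∃ Z, V₃ Z) {X : A}
    (hX : V₁ X) : R.gluedRight V₁ V₃ (R.iStar.obj X) :=
  ⟨h₁.of_iso (R.iShriekIStarIso X).symm hX,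
    hV₃.elim fun _ hZ => h₃.of_isZero hZ (R.isZero_jUpper_iStar X)⟩

lemma gluedRight_jStar (h₁ : IsSubcategory V₁) (h₃ : IsSubcategory V₃) (hV₁ : ∃ Z, V₁ Z) {X : C}
    (hX : V₃ X) : R.gluedRight V₁ V₃ (R.jStar.obj X) :=
  have := R.isIso_jStarAdj_counit X
  ⟨hV₁.elim fun _ hZ => h₁.of_isZero hZ (R.isZero_iShriek_jStar X),
    h₃.of_iso (asIso (R.jStarAdj.counit.app X)).symm hX⟩

lemma leftPerp_iStar (iShriek_exact : IsExact SB SA R.iShriek) {X : A} (hX : SA.leftPerp V₁ X) :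
    SB.leftPerp (R.gluedRight V₁ V₃) (R.iStar.obj X) := fun _ hY =>
  ext_eq_zero_of_adjunction R.iShriekAdj iShriek_exact.isTriangle (hX _ hY.1)

lemma leftPerp_jShriek {X : C} (hX : SC.leftPerp V₃ X) :
    SB.leftPerp (R.gluedRight V₁ V₃) (R.jShriek.obj X) := fun _ hY =>
  ext_eq_zero_of_adjunction R.jShriekAdj R.jUpper_exact.isTriangle (hX _ hY.2)

lemma exists_triangle_gluedRight (iShriek_exact : IsExact SB SA R.iShriek)
    (jShriek_exact : IsExact SC SB R.jShriek) {U₁ : ObjectProperty A} {U₃ : ObjectProperty C}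
    (pair₁ : SA.IsCotorsionPair U₁ V₁) (pair₃ : SC.IsCotorsionPair U₃ V₃) (M : B) :
    ∃ (V W : B) (x : M ⟶ V) (y : V ⟶ W), R.gluedRight V₁ V₃ V ∧
      SB.leftPerp (R.gluedRight V₁ V₃) W ∧ SB.IsTriangle x y := by
  obtain ⟨V, U, x, y, hV, hU, hxy⟩ := pair₃.exists_right (R.jUpper.obj M)
  obtain ⟨δ, hδ⟩ := jShriek_exact.isTriangle hxy
  have := R.isIso_jUpper_map_counit M
  obtain ⟨M₁, f, f', hM₁⟩ := SB.exists_realizes (push SB.E (R.jShriekAdj.counit.app M) δ)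
  obtain ⟨e₁⟩ := R.jUpper_exact.nonempty_iso_of_push hδ _ hM₁
  obtain ⟨V', U', x', y', hV', hU', hxy'⟩ := pair₁.exists_right (R.iShriek.obj M₁)
  obtain ⟨δ', hδ'⟩ := R.iStar_exact.isTriangle hxy'
  have := R.isIso_iShriek_map_counit M₁
  obtain ⟨M₂, g, g', hM₂⟩ := SB.exists_realizes (push SB.E (R.iShriekAdj.counit.app M₁) δ')
  obtain ⟨e₂⟩ := iShriek_exact.nonempty_iso_of_push hδ' _ hM₂
  have := (R.jUpper_exact.isTriangle ⟨_, hM₂⟩).isIso_of_isZero (R.isZero_jUpper_iStar U')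
  obtain ⟨W, h, d, e, δ'', hW, -, -, hde, -, -⟩ := SB.et4 hM₁ hM₂
  refine ⟨M₂, W, _, _, ⟨?_, ?_⟩, ?_, ⟨δ'', hW⟩⟩
  · exact pair₁.right.of_iso ((R.iShriekIStarIso V').symm ≪≫ e₂) hV'
  · exact pair₃.right.of_iso ((R.jUpperJShriekIso V).symm ≪≫ e₁ ≪≫ asIso (R.jUpper.map g)) hV
  · exact leftPerp_of_isTriangle _ ⟨_, hde⟩
      (R.leftPerp_jShriek fun _ hY => pair₃.ext_eq_zero hU hY)
      (R.leftPerp_iStar iShriek_exact fun _ hY => pair₁.ext_eq_zero hU' hY)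

lemma leftPerp_gluedRight_le (wicC : SC.WIC) (iShriek_exact : IsExact SB SA R.iShriek)
    {U₁ : ObjectProperty A} {U₃ : ObjectProperty C}
    (pair₁ : SA.IsCotorsionPair U₁ V₁) (pair₃ : SC.IsCotorsionPair U₃ V₃) :
    SB.leftPerp (R.gluedRight V₁ V₃) ≤ R.gluedLeft U₁ U₃ := fun X hX =>
  have hV₁ : ∃ Z, V₁ Z :=
    let ⟨Z, _, _, _, hZ, _⟩ := pair₁.exists_right (R.iUpper.obj X)
    ⟨Z, hZ⟩
  have hV₃ : ∃ Z, V₃ Z :=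
    let ⟨Z, _, _, _, hZ, _⟩ := pair₃.exists_right (R.jUpper.obj X)
    ⟨Z, hZ⟩
  ⟨pair₁.of_leftPerp fun _ hY => ext_eq_zero_of_adjunction R.iUpperAdj R.iStar_exact.isTriangle
      (hX _ (R.gluedRight_iStar pair₁.right pair₃.right hV₃ hY)),
    pair₃.of_leftPerp fun _ hY => ext_eq_zero_of_adjunction R.jStarAdj
      (R.jStar_isTriangle wicC iShriek_exact)
      (hX _ (R.gluedRight_jStar pair₁.right pair₃.right hV₁ hY))⟩

end Recollement

end Extri

end

theorem mainTheorem1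
    {A : Type u₁} [Category.{v₁} A] [Preadditive A] [HasFiniteBiproducts A]
    {B : Type u₂} [Category.{v₂} B] [Preadditive B] [HasFiniteBiproducts B]
    {C : Type u₃} [Category.{v₃} C] [Preadditive C] [HasFiniteBiproducts C]
    (SA : Extri.ExtStructure.{w₁} A) (SB : Extri.ExtStructure.{w₂} B)
    (SC : Extri.ExtStructure.{w₃} C)
    (wicA : SA.WIC) (wicB : SB.WIC) (wicC : SC.WIC)
    (R : Extri.Recollement SA SB SC)
    (enough : SB.EnoughProjectives)
    (iShriek_exact : Extri.IsExact SB SA R.iShriek)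
    (jShriek_exact : Extri.IsExact SC SB R.jShriek)
    (U₁ V₁ : ObjectProperty A) (U₃ V₃ : ObjectProperty C)
    (pair₁ : SA.IsCotorsionPair U₁ V₁) (pair₃ : SC.IsCotorsionPair U₃ V₃) :
    SB.IsCotorsionPair (SB.leftPerp (R.gluedRight V₁ V₃)) (R.gluedRight V₁ V₃) ∧
      SB.leftPerp (R.gluedRight V₁ V₃) ≤ Extri.addClosure (R.gluedLeft U₁ U₃) :=
  ⟨Extri.ExtStructure.isCotorsionPair_leftPerp enough
    (R.gluedRight_isSubcategory pair₁.right pair₃.right)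
    (R.exists_triangle_gluedRight iShriek_exact jShriek_exact pair₁ pair₃),
  (R.leftPerp_gluedRight_le wicC iShriek_exact pair₁ pair₃).trans
    (Extri.ExtStructure.le_addClosure _)⟩
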